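/- Let $n \ge 2$ and let $E \subset \mathbb{R}^n$ be an open or closed unit ball (with the Euclidean distance). A *contour* of a function $f : X \to \mathbb{R}$ on a topological space $X$ is a connected component of a level set $f^{-1}(t)$, $t \in \mathbb{R}$. The *Reeb width* of a metric space $X$ is $$b(X) = \inf_{\substack{f : X \to \mathbb{R}\\ \text{continuous}}}\ \sup_{C \text{ contour of } f} \operatorname{diam}(C) \in [0,\infty].$$ Then: (i) if $n = 2$, then $b(E) \ge \sqrt{3}$; (ii) if $n \ge 3$, then $b(E) = 2$. Moreover, for every continuous function $f : E \to \mathbb{R}$ there exist points $x, y \in \partial E$ (the boundary of $E$ in $\mathbb{R}^n$), with $\|x - y\| \ge \sqrt{3}$ if $n = 2$ and $\|x - y\| = 2$ if $n \ge 3$, such that for every neighborhood $U$ of $x$ and every neighborhood $V$ of $y$ in $\mathbb{R}^n$ there exists a contour $C$ of $f$ with $C \cap U \ne \emptyset$ and $C \cap V \ne \emptyset$. -/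

import Mathlib

open scoped ENNReal

/-- A contour of `f` is a connected component of a (non-empty) level set of `f`. -/
def IsContour {X : Type*} [TopologicalSpace X] (f : X → ℝ) (C : Set X) : Prop :=
  ∃ t : ℝ, ∃ p ∈ f ⁻¹' {t}, C = connectedComponentIn (f ⁻¹' {t}) p

/-- The Reeb width of a metric space: the infimum, over all real-valued continuous functions,
of the suprema of the diameters of their contours, with values in `[0, ∞]`. -/
noncomputable def reebWidth (X : Type*) [MetricSpace X] : ℝ≥0∞ :=
  ⨅ (f : X → ℝ) (_ : Continuous f), ⨆ (C : Set X) (_ : IsContour f C), Metric.ediam C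

open Set Topology

/-! The core is `Unicoherent.exists_isContour_rel`, where `R` stands for "far apart". Suppose that
no contour contains an `R`-pair. Each contour then has a complementary component whose complement, a
small side of the contour, is free of `R`-pairs. Zorn's lemma applies to small sides: by
`Unicoherent.exists_isContour_of_chain`, a chain without greatest element has its union bounded by a
single contour, and a small side of that contour contains the union, since otherwise the space would
split into two `R`-free pieces.

Let `F` be a maximal small side. Any two points outside `F` are joined by a path outside `F`, and
`Unicoherent.exists_isContour_separating` gives a contour separating this path from the contour of
`F`. A small side of the new contour contains either both points, which are then unrelated, or all
of `F` and more, against maximality. So `F` and its complement are both `R`-free, which the covering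
hypothesis forbids.

For `n ≥ 3` this is applied to the sphere with `R` the antipodal relation. For `n = 2` it is applied
to the closed disc, with `R` relating boundary points at distance at least `√3`, the side of the
inscribed equilateral triangle: two of its three vertices always fall in the same piece.
Unicoherence comes from lifting circle-valued maps to the line. To reach open balls and the
boundary, the result is used on copies scaled by factors tending to `1`, and compactness supplies
the limit points. -/

/-- A topological space is unicoherent if the intersection of any two closed connected sets
covering it is connected. -/
def Unicoherent (X : Type*) [TopologicalSpace X] : Prop :=
  ∀ A B : Set X, IsClosed A → IsClosed B → IsPreconnected A → IsPreconnected B →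
    A ∪ B = univ → IsPreconnected (A ∩ B)

/-! ### Frontiers of complementary components -/

section Components

variable {X : Type*} [TopologicalSpace X]

theorem IsPreconnected.subset_of_disjoint_frontier {D W : Set X} (hD : IsPreconnected D)
    (hW : IsOpen W) (hdisj : Disjoint D (frontier W)) (hne : (D ∩ W).Nonempty) : D ⊆ W := by
  refine hD.subset_of_closure_inter_subset hW hne ?_
  rintro y ⟨hy, hyD⟩
  by_contra hyW
  exact hdisj.notMem_of_mem_left hyD (by rw [hW.frontier_eq]; exact ⟨hy, hyW⟩)

theorem frontier_connectedComponentIn_subset_compl [LocallyConnectedSpace X] {O : Set X}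
    (hO : IsOpen O) (x : X) : frontier (connectedComponentIn O x) ⊆ Oᶜ := by
  intro y hy hyO
  rw [hO.connectedComponentIn.frontier_eq] at hy
  obtain ⟨z, hz, hz'⟩ := mem_closure_iff.1 hy.1 _ (hO.connectedComponentIn (x := y))
    (mem_connectedComponentIn hyO)
  apply hy.2
  rw [connectedComponentIn_eq hz', ← connectedComponentIn_eq hz]
  exact mem_connectedComponentIn hyO

/-- The frontier of the component lies in `A`, so a part of its complement split off from `A` would
be clopen in the whole space. -/
theorem isPreconnected_compl_connectedComponentIn_compl [LocallyConnectedSpace X]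
    [PreconnectedSpace X] {A : Set X} (hA : IsClosed A) (hAc : IsConnected A) (x : X) :
    IsPreconnected (connectedComponentIn Aᶜ x)ᶜ := by
  set W := connectedComponentIn Aᶜ x with hWdef
  have hW : IsOpen W := hA.isOpen_compl.connectedComponentIn
  have hAW : A ⊆ Wᶜ := fun a ha haW => connectedComponentIn_subset _ _ haW ha
  have hfr : frontier W ⊆ A := by
    simpa using frontier_connectedComponentIn_subset_compl hA.isOpen_compl x
  have key : ∀ u v : Set X, IsClosed u → IsClosed v → Wᶜ ⊆ u ∪ v → Disjoint u v → A ⊆ u →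
      Wᶜ ⊆ u := by
    intro u v hu hv huv hdis hAu
    have hcompl : (Wᶜ ∩ v)ᶜ = closure W ∪ (Wᶜ ∩ u) := by
      ext y
      simp only [mem_compl_iff, mem_inter_iff, not_and, mem_union, closure_eq_self_union_frontier]
      constructor
      · intro h
        by_cases hy : y ∈ W
        · exact Or.inl (Or.inl hy)
        · exact Or.inr ⟨hy, (huv hy).resolve_right (h hy)⟩
      · rintro ((h | h) | h) hy
        · exact absurd h hy
        · exact hdis.notMem_of_mem_left (hAu (hfr h))
        · exact hdis.notMem_of_mem_left h.2
    have hclopen : IsClopen (Wᶜ ∩ v) := by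
      refine ⟨hW.isClosed_compl.inter hv, ?_⟩
      rw [← isClosed_compl_iff, hcompl]
      exact isClosed_closure.union (hW.isClosed_compl.inter hu)
    rcases isClopen_iff.1 hclopen with h | h
    · intro y hy
      refine (huv hy).resolve_right fun hyv => ?_
      have : y ∈ Wᶜ ∩ v := ⟨hy, hyv⟩
      rw [h] at this
      exact this
    · obtain ⟨a, ha⟩ := hAc.nonempty
      have : a ∈ Wᶜ ∩ v := h ▸ mem_univ a
      exact absurd this.2 (hdis.notMem_of_mem_left (hAu ha))
  rw [isPreconnected_iff_subset_of_fully_disjoint_closed hW.isClosed_compl]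
  intro u v hu hv huv hdis
  rcases (isPreconnected_iff_subset_of_fully_disjoint_closed hA).1 hAc.isPreconnected u v hu hv
    (hAW.trans huv) hdis with h | h
  · exact Or.inl (key u v hu hv huv hdis h)
  · exact Or.inr (key v u hv hu (by rwa [union_comm]) hdis.symm h)

/-- Take for `W` the component of `(closure V)ᶜ` containing `J`. Its frontier is `closure W ∩ Wᶜ`,
and these are connected closed sets covering the space. -/
theorem Unicoherent.exists_isOpen_frontier_isPreconnected [LocallyConnectedSpace X]
    [PreconnectedSpace X] (hX : Unicoherent X) {V J : Set X} (hV : IsOpen V) (hVc : IsConnected V)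
    (hJ : IsConnected J) (hJV : Disjoint J (closure V)) :
    ∃ W : Set X, IsOpen W ∧ IsPreconnected W ∧ J ⊆ W ∧ Disjoint W (closure V) ∧
      frontier W ⊆ frontier V ∧ IsPreconnected (frontier W) := by
  obtain ⟨j, hj⟩ := hJ.nonempty
  have hO : IsOpen (closure V)ᶜ := isClosed_closure.isOpen_compl
  have hW : IsOpen (connectedComponentIn (closure V)ᶜ j) := hO.connectedComponentIn
  have hWV : Disjoint (connectedComponentIn (closure V)ᶜ j) (closure V) :=
    disjoint_compl_left.mono_left (connectedComponentIn_subset _ _)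
  refine ⟨connectedComponentIn (closure V)ᶜ j, hW, isPreconnected_connectedComponentIn,
    hJ.isPreconnected.subset_connectedComponentIn hj hJV.subset_compl_right, hWV, ?_, ?_⟩
  · intro y hy
    rw [hV.frontier_eq]
    refine ⟨by simpa using frontier_connectedComponentIn_subset_compl hO j hy, fun hyV => ?_⟩
    exact ((hWV.mono_right subset_closure).closure_left hV).notMem_of_mem_left
      (frontier_subset_closure hy) hyV
  · rw [hW.frontier_eq, sdiff_eq]
    refine hX _ _ isClosed_closure hW.isClosed_compl isPreconnected_connectedComponentIn.closure
      (isPreconnected_compl_connectedComponentIn_compl isClosed_closure hVc.closure j) ?_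
    exact eq_univ_of_subset (union_subset_union_left _ subset_closure) (union_compl_self _)

end Components

/-! ### Contours and their separation from connected sets -/

section Contours

variable {X : Type*} [TopologicalSpace X] {f : X → ℝ} {C C' : Set X}

namespace IsContour

theorem isConnected (hC : IsContour f C) : IsConnected C := by
  obtain ⟨t, p, hp, rfl⟩ := hC
  exact isConnected_connectedComponentIn_iff.2 hp

theorem eq_of_mem (hC : IsContour f C) {x y : X} (hx : x ∈ C) (hy : y ∈ C) : f x = f y := by
  obtain ⟨t, p, hp, rfl⟩ := hC
  have h1 : f x = t := connectedComponentIn_subset (f ⁻¹' {t}) p hx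
  have h2 : f y = t := connectedComponentIn_subset (f ⁻¹' {t}) p hy
  rw [h1, h2]

theorem eq_connectedComponentIn (hC : IsContour f C) {x : X} (hx : x ∈ C) :
    C = connectedComponentIn (f ⁻¹' {f x}) x := by
  obtain ⟨t, p, hp, rfl⟩ := hC
  have h1 : f x = t := connectedComponentIn_subset (f ⁻¹' {t}) p hx
  rw [h1, connectedComponentIn_eq hx]

theorem eq_of_inter_nonempty (hC : IsContour f C) (hC' : IsContour f C')
    (h : (C ∩ C').Nonempty) : C = C' := by
  obtain ⟨x, hx, hx'⟩ := h
  rw [hC.eq_connectedComponentIn hx, hC'.eq_connectedComponentIn hx']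

theorem isClosed (hC : IsContour f C) (hf : Continuous f) : IsClosed C := by
  obtain ⟨x, hx⟩ := hC.isConnected.nonempty
  refine isClosed_of_closure_subset ?_
  have hsub : closure C ⊆ f ⁻¹' {f x} :=
    closure_minimal (fun y hy => hC.eq_of_mem hy hx) (isClosed_singleton.preimage hf)
  have := hC.isConnected.isPreconnected.closure.subset_connectedComponentIn
    (subset_closure hx) hsub
  rwa [← hC.eq_connectedComponentIn hx] at this

theorem neg (hC : IsContour f C) : IsContour (fun x => -f x) C := by
  obtain ⟨t, p, hp, rfl⟩ := hC
  have h : (fun x => -f x) ⁻¹' {-t} = f ⁻¹' {t} := by ext; simp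
  exact ⟨-t, p, by rw [h]; exact hp, by rw [h]⟩

end IsContour

theorem isContour_connectedComponentIn (f : X → ℝ) (x : X) :
    IsContour f (connectedComponentIn (f ⁻¹' {f x}) x) :=
  ⟨f x, x, rfl, rfl⟩

theorem IsContour.neg_iff : IsContour (fun x => -f x) C ↔ IsContour f C :=
  ⟨fun h => by simpa using h.neg, IsContour.neg⟩

variable [CompactSpace X] [LocallyConnectedSpace X] [PreconnectedSpace X]

/-- A contour disjoint from a compact connected set `J` can be fenced off from `J` by a connected
open set whose connected frontier misses the level of the contour. -/
theorem Unicoherent.exists_isOpen_of_isContour [T2Space X] (hX : Unicoherent X) (hf : Continuous f)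
    {J : Set X} (hJ : IsClosed J) (hJc : IsConnected J) {p : X}
    (hdis : Disjoint (connectedComponentIn (f ⁻¹' {f p}) p) J) :
    ∃ W : Set X, IsOpen W ∧ J ⊆ W ∧ Disjoint (connectedComponentIn (f ⁻¹' {f p}) p) (closure W) ∧
      IsPreconnected (frontier W) ∧ ∀ y ∈ frontier W, f y ≠ f p := by
  set L := f ⁻¹' {f p} with hL
  have hLc : IsClosed L := isClosed_singleton.preimage hf
  have : CompactSpace L := isCompact_iff_compactSpace.1 hLc.isCompact
  have hpL : p ∈ L := rfl
  -- In the compact space `L` a component is the intersection of the clopen sets around it, so one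
  -- of these already misses `J`.
  obtain ⟨s, hs, hps, hsJ⟩ : ∃ s : Set L, IsClopen s ∧ (⟨p, hpL⟩ : L) ∈ s ∧
      Disjoint s (Subtype.val ⁻¹' J) := by
    rw [connectedComponentIn_eq_image hpL] at hdis
    have h0 : connectedComponent (⟨p, hpL⟩ : L) ⊆ (Subtype.val ⁻¹' J)ᶜ := fun y hy hyJ =>
      hdis.notMem_of_mem_left (mem_image_of_mem _ hy) hyJ
    rw [connectedComponent_eq_iInter_isClopen] at h0
    have : Nonempty {s : Set L // IsClopen s ∧ (⟨p, hpL⟩ : L) ∈ s} :=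
      ⟨⟨univ, isClopen_univ, mem_univ _⟩⟩
    obtain ⟨⟨s, hs, hps⟩, hsub⟩ := exists_subset_nhds_of_compactSpace
      (V := fun s : {s : Set L // IsClopen s ∧ (⟨p, hpL⟩ : L) ∈ s} => (s : Set L))
      (fun a b => ⟨⟨a ∩ b, a.2.1.inter b.2.1, a.2.2, b.2.2⟩, inter_subset_left,
        inter_subset_right⟩) (fun s => s.2.1.isClosed) (U := (Subtype.val ⁻¹' J)ᶜ)
      (fun y hy => (hJ.preimage continuous_subtype_val).isOpen_compl.mem_nhds (h0 hy))
    exact ⟨s, hs, hps, disjoint_compl_left.mono_left hsub⟩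
  have hP : IsClosed (Subtype.val '' s) := (hs.isClosed.isCompact.image continuous_subtype_val).isClosed
  have hQ : IsClosed (Subtype.val '' sᶜ) :=
    (hs.compl.isClosed.isCompact.image continuous_subtype_val).isClosed
  have hPB : Subtype.val '' s ⊆ (Subtype.val '' sᶜ ∪ J)ᶜ := by
    rintro _ ⟨y, hy, rfl⟩ (⟨z, hz, hzy⟩ | hyJ)
    · exact hz (Subtype.ext hzy ▸ hy)
    · exact hsJ.notMem_of_mem_left hy hyJ
  -- One part of `L` lies in `N`, the other off `closure N`. The frontier of the component of `p` in
  -- `N` lies in `closure N` but not in `N`, hence misses `L`.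
  obtain ⟨N, hN, hPN, hNB⟩ := normal_exists_closure_subset hP (hQ.union hJ).isOpen_compl hPB
  have hCN : connectedComponentIn L p ⊆ N := by
    rw [connectedComponentIn_eq_image hpL]
    exact (image_mono (hs.connectedComponent_subset hps)).trans hPN
  have hpN : p ∈ N := hCN (mem_connectedComponentIn hpL)
  have hCV : connectedComponentIn L p ⊆ connectedComponentIn N p :=
    isPreconnected_connectedComponentIn.subset_connectedComponentIn
      (mem_connectedComponentIn hpL) hCN
  have hV : IsOpen (connectedComponentIn N p) := hN.connectedComponentIn
  have hVN : closure (connectedComponentIn N p) ⊆ closure N :=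
    closure_mono (connectedComponentIn_subset _ _)
  obtain ⟨W, hW, -, hJW, hWV, hWfr, hWc⟩ := hX.exists_isOpen_frontier_isPreconnected
    hV (isConnected_connectedComponentIn_iff.2 hpN) hJc
    (disjoint_left.2 fun y hyJ hy => hNB (hVN hy) (Or.inr hyJ))
  refine ⟨W, hW, hJW, ?_, hWc, fun y hy hyp => ?_⟩
  · exact ((hWV.mono_right subset_closure).closure_left hV).symm.mono_left hCV
  · have hyV := hWfr hy
    have hyN : y ∉ N := frontier_connectedComponentIn_subset_compl hN p hyV
    have hyL : y ∈ L := hyp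
    by_cases h : (⟨y, hyL⟩ : L) ∈ s
    · exact hyN (hPN ⟨_, h, rfl⟩)
    · exact hNB (hVN (frontier_subset_closure hyV)) (Or.inl ⟨_, h, rfl⟩)

/-- Choose `t` between `f p` and the minimum of `f` on the fence. The component of `{f < t}` at `p`
cannot cross the fence, and its frontier on the side of `J` is connected with `f = t` there. The
contour through that frontier separates. -/
theorem Unicoherent.exists_isContour_separating_of_lt (hX : Unicoherent X) (hf : Continuous f)
    {J W : Set X} (hJc : IsConnected J) {p : X} (hW : IsOpen W) (hJW : J ⊆ W)
    (hdis : Disjoint (connectedComponentIn (f ⁻¹' {f p}) p) (closure W))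
    (hlt : ∀ y ∈ frontier W, f p < f y) :
    ∃ C' : Set X, IsContour f C' ∧ Disjoint C' (connectedComponentIn (f ⁻¹' {f p}) p) ∧
      Disjoint C' J ∧ ∀ D : Set X, IsPreconnected D → Disjoint D C' →
        (D ∩ connectedComponentIn (f ⁻¹' {f p}) p).Nonempty → Disjoint D J := by
  set C := connectedComponentIn (f ⁻¹' {f p}) p with hCdef
  have hpC : p ∈ C := mem_connectedComponentIn rfl
  obtain ⟨j, hj⟩ := hJc.nonempty
  obtain ⟨t, hpt, ht⟩ : ∃ t, f p < t ∧ ∀ y ∈ frontier W, t < f y := by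
    have hne : (frontier W).Nonempty := nonempty_frontier_iff.2 ⟨⟨j, hJW hj⟩, fun h =>
      hdis.notMem_of_mem_left hpC (subset_closure (h ▸ mem_univ p))⟩
    obtain ⟨z, hz, hmin⟩ := isClosed_frontier.isCompact.exists_isMinOn hne hf.continuousOn
    obtain ⟨t, h1, h2⟩ := exists_between (hlt z hz)
    exact ⟨t, h1, fun y hy => h2.trans_le (hmin hy)⟩
  set O := {x | f x < t} with hOdef
  have hO : IsOpen O := isOpen_lt hf continuous_const
  set V := connectedComponentIn O p with hVdef
  have hV : IsOpen V := hO.connectedComponentIn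
  have hpV : p ∈ V := mem_connectedComponentIn hpt
  have hCV : C ⊆ V := by
    refine isPreconnected_connectedComponentIn.subset_connectedComponentIn hpC fun y hy => ?_
    have : f y = f p := connectedComponentIn_subset (f ⁻¹' {f p}) p hy
    exact this.trans_lt hpt
  have hVW : V ⊆ (closure W)ᶜ := by
    refine isPreconnected_connectedComponentIn.subset_of_disjoint_frontier
      isClosed_closure.isOpen_compl ?_ ⟨p, hpV, hdis.notMem_of_mem_left hpC⟩
    rw [frontier_compl]
    refine disjoint_left.2 fun y hyV hy => ?_
    exact (ht y (frontier_closure_subset hy)).not_gt (connectedComponentIn_subset O p hyV)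
  have hWV : Disjoint W (closure V) :=
    (disjoint_left.2 fun y hyW hyV => hVW hyV (subset_closure hyW)).closure_right hW
  obtain ⟨W', hW', -, hJW', hWV', hfr, hfrc⟩ := hX.exists_isOpen_frontier_isPreconnected hV
    (isConnected_connectedComponentIn_iff.2 hpt) hJc (hWV.mono_left hJW)
  obtain ⟨q, hq⟩ : (frontier W').Nonempty := nonempty_frontier_iff.2 ⟨⟨j, hJW' hj⟩, fun h =>
    hWV'.notMem_of_mem_left (h ▸ mem_univ p) (subset_closure hpV)⟩
  have hval : ∀ y ∈ frontier W', f y = t := by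
    intro y hy
    have hyV := hfr hy
    have h1 : ¬ f y < t := frontier_connectedComponentIn_subset_compl hO p hyV
    have h2 : f y ≤ t := closure_minimal
      (fun z hz => le_of_lt (a := f z) (connectedComponentIn_subset O p hz) : V ⊆ {z | f z ≤ t})
      (isClosed_le hf continuous_const) (frontier_subset_closure hyV)
    exact le_antisymm h2 (not_lt.1 h1)
  set C' := connectedComponentIn (f ⁻¹' {f q}) q with hCdef'
  have hC' : IsContour f C' := isContour_connectedComponentIn f q
  have hqC' : q ∈ C' := mem_connectedComponentIn rfl
  have hvalC' : ∀ y ∈ C', f y = t := fun y hy => (hC'.eq_of_mem hy hqC').trans (hval q hq)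
  have hfrC' : frontier W' ⊆ C' :=
    hfrc.subset_connectedComponentIn hq fun y hy => (hval y hy).trans (hval q hq).symm
  refine ⟨C', hC', disjoint_left.2 fun y hy hyC => ?_, disjoint_left.2 fun y hy hyJ => ?_, ?_⟩
  · have : f y = f p := connectedComponentIn_subset (f ⁻¹' {f p}) p hyC
    linarith [hvalC' y hy]
  · have hsub : C' ⊆ W := isPreconnected_connectedComponentIn.subset_of_disjoint_frontier hW
      (disjoint_left.2 fun z hz hzW => (ht z hzW).ne' (hvalC' z hz)) ⟨y, hy, hJW hyJ⟩
    exact hWV.notMem_of_mem_left (hsub hqC') (frontier_subset_closure (hfr hq))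
  · rintro D hD hDC' ⟨z, hzD, hzC⟩
    refine disjoint_left.2 fun y hyD hyJ => ?_
    have := hD.subset_of_disjoint_frontier hW' (hDC'.mono_right hfrC') ⟨y, hyD, hJW' hyJ⟩
    exact hWV'.notMem_of_mem_left (this hzD) (subset_closure (hCV hzC))

/-- In a unicoherent space, a contour can be separated from any disjoint closed connected set by
another contour. -/
theorem Unicoherent.exists_isContour_separating [T2Space X] (hX : Unicoherent X) (hf : Continuous f)
    {J : Set X} (hJ : IsClosed J) (hJc : IsConnected J) (hC : IsContour f C)
    (hdis : Disjoint C J) :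
    ∃ C' : Set X, IsContour f C' ∧ Disjoint C' C ∧ Disjoint C' J ∧
      ∀ D : Set X, IsPreconnected D → Disjoint D C' → (D ∩ C).Nonempty → Disjoint D J := by
  obtain ⟨p, hp⟩ := hC.isConnected.nonempty
  obtain rfl := hC.eq_connectedComponentIn hp
  obtain ⟨W, hW, hJW, hCW, hWc, hne⟩ := hX.exists_isOpen_of_isContour hf hJ hJc hdis
  by_cases hlt : ∀ y ∈ frontier W, f p < f y
  · exact hX.exists_isContour_separating_of_lt hf hJc hW hJW hCW hlt
  -- The connected frontier misses the level, so `f - f p` has constant sign on it; the negative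
  -- case reduces to `-f`.
  · have hgt : ∀ y ∈ frontier W, f y < f p := by
      push Not at hlt
      obtain ⟨y, hy, hyp⟩ := hlt
      intro z hz
      by_contra hzp
      obtain ⟨w, hw, hwp⟩ := hWc.intermediate_value hy hz hf.continuousOn
        ⟨hyp, not_lt.1 hzp⟩
      exact hne w hw hwp
    have hpre : (fun x => -f x) ⁻¹' {-f p} = f ⁻¹' {f p} := by ext; simp
    have := hX.exists_isContour_separating_of_lt (f := fun x => -f x) hf.neg hJc (p := p) hW hJW
      (by rw [hpre]; exact hCW) (fun y hy => neg_lt_neg (hgt y hy))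
    simpa only [hpre, IsContour.neg_iff] using this

end Contours

/-! ### Small sides of contours and their chains -/

section SmallSides

variable {X : Type*} [TopologicalSpace X]

/-- The complements of those complementary components of contours that contain no two points
related by `R`. -/
def smallSides (f : X → ℝ) (R : X → X → Prop) : Set (Set X) :=
  {F | (∀ y ∈ F, ∀ z ∈ F, ¬ R y z) ∧ ∃ C x, IsContour f C ∧ x ∉ C ∧
    F = (connectedComponentIn Cᶜ x)ᶜ}

theorem subset_compl_connectedComponentIn_compl (C : Set X) (x : X) :
    C ⊆ (connectedComponentIn Cᶜ x)ᶜ :=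
  fun _ hc h => connectedComponentIn_subset Cᶜ x h hc

theorem not_rel_of_mem_sUnion_smallSides {f : X → ℝ} {R : X → X → Prop} {c : Set (Set X)} (hc : c ⊆ smallSides f R)
    (hchain : IsChain (· ⊆ ·) c) : ∀ y ∈ ⋃₀ c, ∀ z ∈ ⋃₀ c, ¬ R y z := by
  rintro y ⟨F, hF, hy⟩ z ⟨F', hF', hz⟩
  rcases hchain.total hF hF' with h | h
  · exact (hc hF').1 y (h hy) z hz
  · exact (hc hF).1 y hy z (h hz)

variable [LocallyConnectedSpace X] {f : X → ℝ} {C C' : Set X} {x x' : X}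

theorem IsContour.frontier_connectedComponentIn_compl_subset (hf : Continuous f)
    (hC : IsContour f C) (x : X) : frontier (connectedComponentIn Cᶜ x) ⊆ C := by
  simpa using frontier_connectedComponentIn_subset_compl (hC.isClosed hf).isOpen_compl x

variable [PreconnectedSpace X]

/-- Equal contours would give equal sides, so `C` and `C'` are disjoint. If `C'` also missed the
component of `Cᶜ`, the closure of that component would lie in the smaller component of `C'ᶜ`, making
it clopen. -/
theorem IsContour.disjoint_of_ssubset (hf : Continuous f) (hC : IsContour f C)
    (hC' : IsContour f C') (hx' : x' ∉ C')
    (hsub : (connectedComponentIn Cᶜ x)ᶜ ⊆ (connectedComponentIn C'ᶜ x')ᶜ)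
    (hne : (connectedComponentIn Cᶜ x)ᶜ ≠ (connectedComponentIn C'ᶜ x')ᶜ) :
    Disjoint C' (connectedComponentIn Cᶜ x)ᶜ := by
  have hUU := compl_subset_compl.1 hsub
  have hxU' : x' ∈ connectedComponentIn C'ᶜ x' := mem_connectedComponentIn hx'
  have hU : IsOpen (connectedComponentIn Cᶜ x) :=
    (hC.isClosed hf).isOpen_compl.connectedComponentIn
  have hfr := hC.frontier_connectedComponentIn_compl_subset hf x
  by_cases hCC : (C ∩ C').Nonempty
  · obtain rfl := hC.eq_of_inter_nonempty hC' hCC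
    exact absurd (congrArg compl (connectedComponentIn_eq (hUU hxU'))) hne
  · have hCC' : Disjoint C C' := disjoint_iff_inter_eq_empty.2 (not_nonempty_iff_eq_empty.1 hCC)
    by_contra hmeet
    have hdis : Disjoint C' (connectedComponentIn Cᶜ x) := by
      by_contra h
      have := hC'.isConnected.isPreconnected.subset_of_disjoint_frontier hU
        (hCC'.symm.mono_right hfr) (not_disjoint_iff_nonempty_inter.1 h)
      exact hmeet (disjoint_compl_right.mono_left this)
    have hcl : Disjoint (closure (connectedComponentIn Cᶜ x)) C' := by
      rw [closure_eq_self_union_frontier]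
      exact disjoint_union_left.2 ⟨hdis.symm, hCC'.mono_left hfr⟩
    have hsub' : closure (connectedComponentIn Cᶜ x) ⊆ connectedComponentIn C'ᶜ x' :=
      isPreconnected_connectedComponentIn.closure.subset_connectedComponentIn
        (subset_closure (hUU hxU')) hcl.subset_compl_right
    have hclosed : IsClosed (connectedComponentIn Cᶜ x) :=
      isClosed_of_closure_subset (hsub'.trans hUU)
    rcases isClopen_iff.1 ⟨hclosed, hU⟩ with h | h
    · exact (h ▸ hUU hxU' : x' ∈ (∅ : Set X))
    · obtain ⟨c, hc⟩ := hC.isConnected.nonempty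
      exact connectedComponentIn_subset Cᶜ x (h ▸ mem_univ c) hc

theorem IsContour.isPreconnected_compl_connectedComponentIn (hf : Continuous f)
    (hC : IsContour f C) (x : X) : IsPreconnected (connectedComponentIn Cᶜ x)ᶜ :=
  isPreconnected_compl_connectedComponentIn_compl (hC.isClosed hf) hC.isConnected x

theorem smallSides.subset_interior {R : X → X → Prop} (hf : Continuous f) {F F' : Set X}
    (hF : F ∈ smallSides f R) (hF' : F' ∈ smallSides f R) (hsub : F ⊆ F') (hne : F ≠ F') :
    F ⊆ interior F' := by
  obtain ⟨-, C, x, hC, -, rfl⟩ := hF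
  obtain ⟨-, C', x', hC', hx', rfl⟩ := hF'
  intro y hy
  by_contra hyi
  have hyfr : y ∈ frontier (connectedComponentIn C'ᶜ x')ᶜ := ⟨subset_closure (hsub hy), hyi⟩
  rw [frontier_compl] at hyfr
  exact (hC.disjoint_of_ssubset hf hC' hx' hsub hne).notMem_of_mem_left
    (hC'.frontier_connectedComponentIn_compl_subset hf x' hyfr) hy

variable [CompactSpace X] [T2Space X]

/-- A chain of small sides without greatest element is absorbed by a single contour, which
contains the frontier of the union of the chain and is disjoint from the union. -/
theorem Unicoherent.exists_isContour_of_chain (hX : Unicoherent X) (hf : Continuous f)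
    {R : X → X → Prop} {c : Set (Set X)} (hc : c ⊆ smallSides f R)
    (hchain : IsChain (· ⊆ ·) c) (hcne : c.Nonempty)
    (hmax : ∀ F ∈ c, ∃ F' ∈ c, F ⊆ F' ∧ F ≠ F') (huniv : ⋃₀ c ≠ univ) :
    IsOpen (⋃₀ c) ∧ IsPreconnected (⋃₀ c) ∧
      ∃ C, IsContour f C ∧ frontier (⋃₀ c) ⊆ C ∧ Disjoint C (⋃₀ c) := by
  set G := ⋃₀ c with hG
  have hint : ∀ F ∈ c, ∃ F' ∈ c, F ⊆ interior F' := fun F hF => by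
    obtain ⟨F', hF', h1, h2⟩ := hmax F hF
    exact ⟨F', hF', smallSides.subset_interior hf (hc hF) (hc hF') h1 h2⟩
  have hGo : IsOpen G := by
    refine isOpen_iff_mem_nhds.2 ?_
    rintro y ⟨F, hF, hy⟩
    obtain ⟨F', hF', h⟩ := hint F hF
    exact Filter.mem_of_superset (isOpen_interior.mem_nhds (h hy))
      (interior_subset.trans (subset_sUnion_of_mem hF'))
  have hGc : IsPreconnected G := by
    refine IsPreconnected.sUnion_directed hchain.directedOn fun F hF => ?_
    obtain ⟨-, C, x, hC, -, rfl⟩ := hc hF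
    exact hC.isPreconnected_compl_connectedComponentIn hf x
  have hGne : G.Nonempty := by
    obtain ⟨F, hF⟩ := hcne
    obtain ⟨-, C, x, hC, -, rfl⟩ := hc hF
    obtain ⟨z, hz⟩ := hC.isConnected.nonempty
    exact ⟨z, _, hF, subset_compl_connectedComponentIn_compl C x hz⟩
  -- A splitting of `Gᶜ` extends to disjoint open sets `P` and `Q`. By compactness some `Fᶜ` lies in
  -- `P ∪ Q`, and `Fᶜ` is connected.
  have hGcc : IsPreconnected Gᶜ := by
    rw [isPreconnected_iff_subset_of_fully_disjoint_closed hGo.isClosed_compl]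
    intro u v hu hv huv hdis
    obtain ⟨P, Q, hP, hQ, huP, hvQ, hPQ⟩ := normal_separation hu hv hdis
    have hK : IsCompact (P ∪ Q)ᶜ := (hP.union hQ).isClosed_compl.isCompact
    have : Nonempty c := hcne.to_subtype
    obtain ⟨⟨F, hF⟩, hKF⟩ := hK.elim_directed_cover (fun F : c => interior (F : Set X))
      (fun F => isOpen_interior) (by
        intro y hy
        have hyG : y ∈ G := by
          by_contra h
          exact hy ((union_subset_union huP hvQ) (huv h))
        obtain ⟨F, hF, hyF⟩ := hyG
        obtain ⟨F', hF', h⟩ := hint F hF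
        exact mem_iUnion.2 ⟨⟨F', hF'⟩, h hyF⟩)
      (fun a b => by
        rcases hchain.total a.2 b.2 with h | h
        · exact ⟨b, interior_mono h, subset_rfl⟩
        · exact ⟨a, subset_rfl, interior_mono h⟩)
    have hGF : Gᶜ ⊆ Fᶜ := compl_subset_compl.2 (subset_sUnion_of_mem hF)
    have hFPQ : Fᶜ ⊆ P ∪ Q := by
      rw [← compl_compl (P ∪ Q)]
      exact compl_subset_compl.2 (hKF.trans interior_subset)
    have hFc : IsPreconnected Fᶜ := by
      obtain ⟨-, C, x, hC, -, rfl⟩ := hc hF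
      rw [compl_compl]
      exact isPreconnected_connectedComponentIn
    rcases hFc.subset_or_subset hP hQ hPQ hFPQ with h | h
    · refine Or.inl fun y hy => (huv hy).resolve_right fun hyv => ?_
      exact hPQ.notMem_of_mem_left (h (hGF hy)) (hvQ hyv)
    · refine Or.inr fun y hy => (huv hy).resolve_left fun hyu => ?_
      exact hPQ.notMem_of_mem_left (huP hyu) (h (hGF hy))
  have hfrc : IsPreconnected (frontier G) := by
    rw [hGo.frontier_eq, sdiff_eq]
    exact hX _ _ isClosed_closure hGo.isClosed_compl hGc.closure hGcc
      (eq_univ_of_subset (union_subset_union_left _ subset_closure) (union_compl_self _))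
  -- A connected set leading from outside `G` into a member of the chain must cross the contour of
  -- that member.
  have hmeet : ∀ N : Set X, IsPreconnected N → ∀ y ∈ N, y ∉ G → ∀ F ∈ c, ∀ C x,
      IsContour f C → F = (connectedComponentIn Cᶜ x)ᶜ → (N ∩ F).Nonempty → (N ∩ C).Nonempty := by
    rintro N hN y hyN hyG F hF C x hC rfl ⟨z, hzN, hzF⟩
    by_contra hdis
    have hyU : y ∈ connectedComponentIn Cᶜ x := by
      by_contra h
      exact hyG ⟨_, hF, h⟩
    refine hzF (hN.subset_of_disjoint_frontier
      (hC.isClosed hf).isOpen_compl.connectedComponentIn ?_ ⟨y, hyN, hyU⟩ hzN)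
    exact (disjoint_iff_inter_eq_empty.2 (not_nonempty_iff_eq_empty.1 hdis)).mono_right
      (hC.frontier_connectedComponentIn_compl_subset hf x)
  obtain ⟨q, hq⟩ : (frontier G).Nonempty := nonempty_frontier_iff.2 ⟨hGne, huniv⟩
  have hfrG : ∀ y ∈ frontier G, y ∈ closure G ∧ y ∉ G := fun y hy => by
    rwa [hGo.frontier_eq] at hy
  have hval : ∀ y ∈ frontier G, f y = f q := by
    intro y hy
    by_contra hne
    obtain ⟨u, v, hu, hv, hyu, hqv, huv⟩ := t2_separation hne
    -- All sufficiently large members of the chain have contours taking values near `f z`. Two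
    -- distinct frontier values would force one contour to take two values.
    have hnear : ∀ w : Set ℝ, IsOpen w → ∀ z ∈ frontier G, f z ∈ w → ∃ F ∈ c, ∀ F' ∈ c, F ⊆ F' →
        ∀ C x, IsContour f C → F' = (connectedComponentIn Cᶜ x)ᶜ → ∃ a ∈ C, f a ∈ w := by
      intro w hw z hz hzw
      have hzN := mem_connectedComponentIn (F := f ⁻¹' w) hzw
      obtain ⟨b, hbN, F, hF, hbF⟩ := mem_closure_iff.1 (hfrG z hz).1 _
        (hw.preimage hf).connectedComponentIn hzN
      refine ⟨F, hF, fun F' hF' hFF' C x hC hCF' => ?_⟩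
      obtain ⟨a, haN, haC⟩ := hmeet _ isPreconnected_connectedComponentIn z hzN (hfrG z hz).2 F' hF'
        C x hC hCF' ⟨b, hbN, hFF' hbF⟩
      exact ⟨a, haC, connectedComponentIn_subset (f ⁻¹' w) z haN⟩
    obtain ⟨F₁, hF₁, h₁⟩ := hnear u hu y hy hyu
    obtain ⟨F₂, hF₂, h₂⟩ := hnear v hv q hq hqv
    obtain ⟨F, hF, hF₁F, hF₂F⟩ := hchain.directedOn F₁ hF₁ F₂ hF₂
    obtain ⟨-, C, x, hC, -, hFC⟩ := hc hF
    obtain ⟨a, haC, ha⟩ := h₁ F hF hF₁F C x hC hFC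
    obtain ⟨b, hbC, hb⟩ := h₂ F hF hF₂F C x hC hFC
    exact huv.notMem_of_mem_left ha (hC.eq_of_mem haC hbC ▸ hb)
  have hC := isContour_connectedComponentIn f q
  have hqC : q ∈ connectedComponentIn (f ⁻¹' {f q}) q := mem_connectedComponentIn rfl
  refine ⟨hGo, hGc, _, hC, hfrc.subset_connectedComponentIn hq hval, ?_⟩
  refine disjoint_left.2 ?_
  rintro z hzC ⟨F, hF, hzF⟩
  -- If the limit contour met a member of the chain, it would coincide with the contours of that
  -- member and of a larger one, but these are disjoint.
  have heq : ∀ F' ∈ c, F ⊆ F' → ∀ C' x, IsContour f C' → F' = (connectedComponentIn C'ᶜ x)ᶜ →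
      connectedComponentIn (f ⁻¹' {f q}) q = C' := fun F' hF' hFF' C' x hC' hFC' =>
    hC.eq_of_inter_nonempty hC' (hmeet _ hC.isConnected.isPreconnected q hqC (hfrG q hq).2 F' hF'
      C' x hC' hFC' ⟨z, hzC, hFF' hzF⟩)
  obtain ⟨F', hF', hFF', hne⟩ := hmax F hF
  obtain ⟨-, C₁, x₁, hC₁, -, h₁⟩ := hc hF
  obtain ⟨-, C₂, x₂, hC₂, hx₂, h₂⟩ := hc hF'
  have e₁ := heq F hF subset_rfl C₁ x₁ hC₁ h₁
  have e₂ := heq F' hF' hFF' C₂ x₂ hC₂ h₂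
  subst h₁ h₂
  have hd := hC₁.disjoint_of_ssubset hf hC₂ hx₂ hFF' hne
  rw [← e₂, e₁] at hd
  obtain ⟨a, ha⟩ := hC₁.isConnected.nonempty
  exact hd.notMem_of_mem_left ha (subset_compl_connectedComponentIn_compl C₁ x₁ ha)

end SmallSides

/-! ### The abstract existence theorem -/

/-- If every contour without `R`-related points has a complementary component whose complement has
no `R`-related points, and the space is not the disjoint union of a closed set and an open set
neither of which has `R`-related points, then some contour has `R`-related points. -/
theorem Unicoherent.exists_isContour_rel {X : Type*} [TopologicalSpace X] [CompactSpace X]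
    [T2Space X] [LocallyPathConnectedSpace X] [ConnectedSpace X] (hX : Unicoherent X)
    (R : X → X → Prop) {f : X → ℝ} (hf : Continuous f)
    (hside : ∀ C : Set X, IsClosed C → IsConnected C → (∀ y ∈ C, ∀ z ∈ C, ¬ R y z) →
      ∃ x ∉ C, ∀ y ∉ connectedComponentIn Cᶜ x, ∀ z ∉ connectedComponentIn Cᶜ x, ¬ R y z)
    (hcover : ∀ A : Set X, IsClosed A → (∀ y ∈ A, ∀ z ∈ A, ¬ R y z) →
      ¬ ∀ y ∉ A, ∀ z ∉ A, ¬ R y z) :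
    ∃ C, IsContour f C ∧ ∃ x ∈ C, ∃ y ∈ C, R x y := by
  by_contra hno
  push Not at hno
  replace hside : ∀ C, IsContour f C → ∃ x ∉ C, (connectedComponentIn Cᶜ x)ᶜ ∈ smallSides f R := by
    intro C hC
    obtain ⟨x, hx, h⟩ := hside C (hC.isClosed hf) hC.isConnected (hno C hC)
    exact ⟨x, hx, h, C, x, hC, hx, rfl⟩
  obtain ⟨F, hF⟩ : ∃ F, Maximal (· ∈ smallSides f R) F := by
    obtain ⟨x₀⟩ := (inferInstance : Nonempty X)
    obtain ⟨x, -, hx⟩ := hside _ (isContour_connectedComponentIn f x₀)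
    refine (zorn_subset_nonempty (smallSides f R) ?_ _ hx).imp fun _ h => h.2
    intro c hc hchain hcne
    by_cases hmax : ∀ F ∈ c, ∃ F' ∈ c, F ⊆ F' ∧ F ≠ F'
    · have hsmall := not_rel_of_mem_sUnion_smallSides hc hchain
      have huniv : ⋃₀ c ≠ univ := fun h =>
        hcover ∅ isClosed_empty (by simp) fun y _ z _ => hsmall y (h ▸ mem_univ y) z (h ▸ mem_univ z)
      obtain ⟨hGo, hGc, C, hC, hfrC, hCG⟩ :=
        hX.exists_isContour_of_chain hf hc hchain hcne hmax huniv
      obtain ⟨x, hx, hxC⟩ := hside C hC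
      refine ⟨_, hxC, fun s hs => (subset_sUnion_of_mem hs).trans ?_⟩
      -- Otherwise the large component of `Cᶜ` meets `⋃₀ c`, and each of these connected sets avoids
      -- what bounds the other, so they coincide. The space is then the union of two `R`-free
      -- pieces.
      by_contra hnot
      obtain ⟨z, hzG, hz⟩ := not_subset.1 hnot
      rw [mem_compl_iff, not_not] at hz
      have hsub : connectedComponentIn Cᶜ x ⊆ ⋃₀ c :=
        isPreconnected_connectedComponentIn.subset_of_disjoint_frontier hGo
          ((disjoint_compl_left.mono_left (connectedComponentIn_subset _ _)).mono_right hfrC)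
          ⟨z, hz, hzG⟩
      have hsup : ⋃₀ c ⊆ connectedComponentIn Cᶜ x :=
        hGc.subset_connectedComponentIn (hsub (mem_connectedComponentIn hx))
          hCG.subset_compl_left
      refine hcover (⋃₀ c)ᶜ hGo.isClosed_compl ?_ ?_
      · rw [hsup.antisymm hsub]
        exact hxC.1
      · simpa only [mem_compl_iff, not_not] using hsmall
    · push Not at hmax
      obtain ⟨F, hF, h⟩ := hmax
      refine ⟨F, hc hF, fun s hs => ?_⟩
      rcases hchain.total hs hF with h' | h'
      · exact h'
      · rw [h s hs h']
  obtain ⟨hsmall, C, x, hC, hx, rfl⟩ := hF.prop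
  set U := connectedComponentIn Cᶜ x with hU
  have hUo : IsOpen U := (hC.isClosed hf).isOpen_compl.connectedComponentIn
  have hUc : IsConnected U := isConnected_connectedComponentIn_iff.2 hx
  have hUC : Disjoint U C := disjoint_compl_left.mono_left (connectedComponentIn_subset _ _)
  have hfrC : frontier U ⊆ C := hC.frontier_connectedComponentIn_compl_subset hf x
  refine hcover Uᶜ hUo.isClosed_compl hsmall ?_
  simp only [mem_compl_iff, not_not]
  intro y hy z hz
  obtain ⟨γ, hγ⟩ := (hUo.isConnected_iff_isPathConnected.1 hUc).joinedIn y hy z hz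
  have hJU : range γ ⊆ U := range_subset_iff.2 hγ
  have hyJ : y ∈ range γ := ⟨0, γ.source⟩
  have hzJ : z ∈ range γ := ⟨1, γ.target⟩
  obtain ⟨C', hC', hCC', hCJ', hsep⟩ := hX.exists_isContour_separating hf
    (isCompact_range γ.continuous).isClosed (isConnected_range γ.continuous) hC
    (hUC.symm.mono_right hJU)
  obtain ⟨x', hx', hF'⟩ := hside C' hC'
  have hU'C' : Disjoint (connectedComponentIn C'ᶜ x') C' :=
    disjoint_compl_left.mono_left (connectedComponentIn_subset _ _)
  -- If the large component of `C'ᶜ` reaches `C`, it misses the path, so `y` and `z` lie in the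
  -- small side of `C'`. If not, that small side contains `Uᶜ` and also `C' ⊆ U`, against
  -- maximality.
  by_cases hmeet : (connectedComponentIn C'ᶜ x' ∩ C).Nonempty
  · have hdis := hsep _ isPreconnected_connectedComponentIn hU'C' hmeet
    exact hF'.1 y (hdis.notMem_of_mem_right hyJ) z (hdis.notMem_of_mem_right hzJ)
  · have hC'U : C' ⊆ U := by
      have hmeetU : (C' ∩ U).Nonempty := by
        by_contra h
        have hdis : Disjoint (closure U) C' := by
          rw [closure_eq_self_union_frontier]
          exact disjoint_union_left.2 ⟨(disjoint_iff_inter_eq_empty.2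
            (not_nonempty_iff_eq_empty.1 h)).symm, hCC'.symm.mono_left hfrC⟩
        obtain ⟨b, hb⟩ : (frontier U).Nonempty := by
          obtain ⟨a, ha⟩ := hC.isConnected.nonempty
          exact nonempty_frontier_iff.2 ⟨hUc.nonempty, fun h =>
            hUC.notMem_of_mem_left (h ▸ mem_univ a) ha⟩
        exact (hsep _ hUc.isPreconnected.closure hdis
          ⟨b, frontier_subset_closure hb, hfrC hb⟩).notMem_of_mem_left
          (subset_closure hy) hyJ
      exact hC'.isConnected.isPreconnected.subset_of_disjoint_frontier hUo
        (hCC'.mono_right hfrC) hmeetU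
    have hle : Uᶜ ⊆ (connectedComponentIn C'ᶜ x')ᶜ := by
      intro w hw hwU'
      have := (hC.isPreconnected_compl_connectedComponentIn hf x).subset_of_disjoint_frontier
        (hC'.isClosed hf).isOpen_compl.connectedComponentIn
        ((disjoint_compl_left.mono_right hC'U).mono_right
          (hC'.frontier_connectedComponentIn_compl_subset hf x')) ⟨w, hw, hwU'⟩
      obtain ⟨a, ha⟩ := hC.isConnected.nonempty
      exact hmeet ⟨a, this (hUC.notMem_of_mem_right ha), ha⟩
    obtain ⟨a, ha⟩ := hC'.isConnected.nonempty
    exact absurd (hC'U ha) (hF.le_of_ge hF' hle (subset_compl_connectedComponentIn_compl C' x' ha))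

/-! ### Unicoherence from lifting circle-valued maps -/

section Lifting

variable {X : Type*} [TopologicalSpace X]

/-- The difference of two lifts is a continuous integer-valued function. -/
theorem IsPreconnected.eq_of_coe_addCircle_eq {S : Set X} (hS : IsPreconnected S) {g h : X → ℝ}
    (hg : ContinuousOn g S) (hh : ContinuousOn h S)
    (hgh : ∀ x ∈ S, (g x : AddCircle (1 : ℝ)) = h x) {x y : X} (hx : x ∈ S) (hy : y ∈ S) :
    g x - h x = g y - h y := by
  refine hS.constant_of_mapsTo (T := (AddSubgroup.zmultiples (1 : ℝ) : Set ℝ))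
    (f := fun z => g z - h z) ⟨inferInstanceAs (DiscreteTopology (AddSubgroup.zmultiples (1 : ℝ)))⟩
    (hg.sub hh) (fun z hz => ?_) hx hy
  have h0 : ((g z - h z : ℝ) : AddCircle (1 : ℝ)) = 0 := by
    rw [AddCircle.coe_sub, hgh z hz, sub_self]
  exact (QuotientAddGroup.eq_zero_iff _).1 h0

/-- A normal space all of whose circle-valued maps lift to the line is unicoherent. -/
theorem unicoherent_of_lifts [NormalSpace X]
    (hlift : ∀ φ : X → AddCircle (1 : ℝ), Continuous φ →
      ∃ θ : X → ℝ, Continuous θ ∧ ∀ x, (θ x : AddCircle (1 : ℝ)) = φ x) :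
    Unicoherent X := by
  classical
  intro A B hA hB hAc hBc hAB
  rw [isPreconnected_iff_subset_of_fully_disjoint_closed (hA.inter hB)]
  intro u v hu hv huv hdis
  by_contra hnot
  push Not at hnot
  obtain ⟨p, hp, hpu⟩ := not_subset.1 hnot.1
  obtain ⟨q, hq, hqv⟩ := not_subset.1 hnot.2
  have hpv := (huv hp).resolve_left hpu
  have hqu := (huv hq).resolve_right hqv
  obtain ⟨g, hg0, hg1, -⟩ := exists_continuous_zero_one_of_isClosed hu hv hdis
  -- On `A ∩ B` the function `g` is `0` or `1`, both trivial in the circle, so `φ` glues. A lift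
  -- differs from `g` by a constant on `A` and is constant on `B`, which is incompatible with `g p =
  -- 1` and `g q = 0`.
  set φ : X → AddCircle (1 : ℝ) := fun x => if x ∈ A then (g x : AddCircle (1 : ℝ)) else 0 with hφ
  have hφA : EqOn φ (fun x => (g x : AddCircle (1 : ℝ))) A := fun x hx => if_pos hx
  have hφB : EqOn φ (fun _ => 0) B := by
    intro x hx
    by_cases hxA : x ∈ A
    · rw [hφA hxA]
      rcases huv ⟨hxA, hx⟩ with h | h
      · simp [hg0 h]
      · simp [hg1 h, AddCircle.coe_period]
    · exact if_neg hxA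
  have hcont : Continuous φ := by
    rw [← continuousOn_univ, ← hAB]
    refine ContinuousOn.union_of_isClosed ?_ ?_ hA hB
    · exact ((AddCircle.continuous_mk' 1).comp g.continuous).continuousOn.congr hφA
    · exact continuousOn_const.congr hφB
  obtain ⟨θ, hθ, hθφ⟩ := hlift φ hcont
  have h1 := hAc.eq_of_coe_addCircle_eq hθ.continuousOn g.continuous.continuousOn
    (fun x hx => (hθφ x).trans (hφA hx)) hp.1 hq.1
  have h2 := hBc.eq_of_coe_addCircle_eq (h := fun _ => 0) hθ.continuousOn continuousOn_const
    (fun x hx => (hθφ x).trans (by simpa using hφB hx)) hp.2 hq.2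
  have h3 : g p = 1 := hg1 hpv
  have h4 : g q = 0 := hg0 hqu
  linarith

theorem exists_lift_of_simplyConnected [SimplyConnectedSpace X] [LocallyPathConnectedSpace X]
    {φ : X → AddCircle (1 : ℝ)} (hφ : Continuous φ) :
    ∃ θ : X → ℝ, Continuous θ ∧ ∀ x, (θ x : AddCircle (1 : ℝ)) = φ x := by
  obtain ⟨x₀⟩ := (inferInstance : Nonempty X)
  obtain ⟨e, he⟩ := QuotientAddGroup.mk_surjective (φ x₀)
  obtain ⟨θ, ⟨-, hθ⟩, -⟩ := (AddCircle.isCoveringMap_coe (1 : ℝ)).existsUnique_continuousMap_lifts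
    ⟨φ, hφ⟩ x₀ e he
  exact ⟨θ, θ.continuous, fun x => congrFun hθ x⟩

/-- On the connected overlap the two lifts differ by one integer, by which the second is shifted. -/
theorem exists_lift_of_union {U V : Set X} (hU : IsOpen U) (hV : IsOpen V) (hUV : U ∪ V = univ)
    (hc : IsPreconnected (U ∩ V)) {φ : X → AddCircle (1 : ℝ)} {θ₁ θ₂ : X → ℝ}
    (h₁ : ContinuousOn θ₁ U) (h₂ : ContinuousOn θ₂ V)
    (hl₁ : ∀ x ∈ U, (θ₁ x : AddCircle (1 : ℝ)) = φ x)
    (hl₂ : ∀ x ∈ V, (θ₂ x : AddCircle (1 : ℝ)) = φ x) :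
    ∃ θ : X → ℝ, Continuous θ ∧ ∀ x, (θ x : AddCircle (1 : ℝ)) = φ x := by
  classical
  obtain ⟨d, hd0, hd⟩ : ∃ d : ℝ, (d : AddCircle (1 : ℝ)) = 0 ∧
      ∀ x ∈ U ∩ V, θ₁ x = θ₂ x + d := by
    rcases (U ∩ V).eq_empty_or_nonempty with h | ⟨p, hp⟩
    · exact ⟨0, by simp, by simp [h]⟩
    · refine ⟨θ₁ p - θ₂ p, ?_, fun x hx => ?_⟩
      · rw [AddCircle.coe_sub, hl₁ p hp.1, hl₂ p hp.2, sub_self]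
      · have := hc.eq_of_coe_addCircle_eq (h₁.mono inter_subset_left)
          (h₂.mono inter_subset_right) (fun z hz => (hl₁ z hz.1).trans (hl₂ z hz.2).symm) hx hp
        linarith
  set θ : X → ℝ := fun x => if x ∈ U then θ₁ x else θ₂ x + d with hθ
  have hθU : EqOn θ θ₁ U := fun x hx => if_pos hx
  have hθV : EqOn θ (fun x => θ₂ x + d) V := by
    intro x hx
    by_cases hxU : x ∈ U
    · exact (hθU hxU).trans (hd x ⟨hxU, hx⟩)
    · exact if_neg hxU
  refine ⟨θ, ?_, fun x => ?_⟩
  · rw [← continuousOn_univ, ← hUV]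
    exact (h₁.congr hθU).union_of_isOpen ((h₂.add continuousOn_const).congr hθV) hU hV
  · rcases (hUV ▸ mem_univ x : x ∈ U ∪ V) with h | h
    · rw [hθU h, hl₁ x h]
    · rw [hθV h, AddCircle.coe_add, hl₂ x h, hd0, add_zero]

end Lifting

theorem Convex.unicoherent {E : Type*} [NormedAddCommGroup E] [NormedSpace ℝ E] {s : Set E}
    (hs : Convex ℝ s) (hne : s.Nonempty) : Unicoherent s := by
  have := hs.contractibleSpace hne
  have := hs.locallyPathConnectedSpace
  exact unicoherent_of_lifts fun φ hφ => exists_lift_of_simplyConnected hφ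

/-! ### Topology of the unit sphere by stereographic projection -/

section Sphere

variable {E : Type*} [NormedAddCommGroup E] [InnerProductSpace ℝ E]

theorem exists_continuousOn_lift_compl_singleton (v : Metric.sphere (0 : E) 1)
    {φ : Metric.sphere (0 : E) 1 → AddCircle (1 : ℝ)} (hφ : Continuous φ) :
    ∃ θ : Metric.sphere (0 : E) 1 → ℝ, ContinuousOn θ {v}ᶜ ∧
      ∀ x ∈ ({v}ᶜ : Set _), (θ x : AddCircle (1 : ℝ)) = φ x := by
  have hv := norm_eq_of_mem_sphere v
  have hs : ContinuousOn (stereographic hv).symm univ := (stereographic hv).continuousOn_symm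
  obtain ⟨θ, hθ, hl⟩ := exists_lift_of_simplyConnected
    (hφ.comp (continuousOn_univ.1 hs))
  refine ⟨θ ∘ stereographic hv, hθ.comp_continuousOn (stereographic hv).continuousOn,
    fun x hx => ?_⟩
  exact (hl _).trans (congrArg φ ((stereographic hv).left_inv hx))

/-- Stereographic projection from `v` sends `-v` to `0`, leaving a punctured vector space of
dimension at least two. -/
theorem isPreconnected_compl_pair_antipodal [FiniteDimensional ℝ E]
    (hE : 3 ≤ Module.finrank ℝ E) (v : Metric.sphere (0 : E) 1) :
    IsPreconnected (({v}ᶜ : Set (Metric.sphere (0 : E) 1)) ∩ {-v}ᶜ) := by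
  have hv := norm_eq_of_mem_sphere v
  have hs : ContinuousOn (stereographic hv).symm univ := (stereographic hv).continuousOn_symm
  have hrank : 1 < Module.rank ℝ (Submodule.span ℝ {(v : E)})ᗮ := by
    have hne : (v : E) ≠ 0 := by
      intro h
      simp [h] at hv
    have h1 := Submodule.finrank_add_finrank_orthogonal (Submodule.span ℝ {(v : E)})
    rw [finrank_span_singleton hne] at h1
    rw [← Module.finrank_eq_rank]
    exact_mod_cast (by omega : 1 < Module.finrank ℝ (Submodule.span ℝ {(v : E)})ᗮ)
  have hpre := (isConnected_compl_singleton_of_one_lt_rank hrank 0).isPreconnected.image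
    (stereographic hv).symm (hs.mono (subset_univ _))
  convert hpre using 1
  ext x
  constructor
  · rintro ⟨hx, hx'⟩
    refine ⟨stereographic hv x, fun h0 => hx' ?_, (stereographic hv).left_inv hx⟩
    have hnv : -v ∈ (stereographic hv).source := (ne_neg_of_mem_unit_sphere ℝ v).symm
    exact (stereographic hv).injOn hx hnv (h0.trans (stereographic_apply_neg v).symm)
  · rintro ⟨w, hw, rfl⟩
    refine ⟨(stereographic hv).map_target (mem_univ w), fun h => hw ?_⟩
    have h2 := (stereographic hv).right_inv (mem_univ w)
    rw [mem_singleton_iff.1 h, stereographic_apply_neg] at h2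
    exact h2.symm

theorem unicoherent_sphere [FiniteDimensional ℝ E] (hE : 3 ≤ Module.finrank ℝ E) :
    Unicoherent (Metric.sphere (0 : E) 1) := by
  refine unicoherent_of_lifts fun φ hφ => ?_
  have : Nontrivial E := Module.nontrivial_of_finrank_pos (R := ℝ) (by omega)
  obtain ⟨v, hv⟩ := NormedSpace.sphere_nonempty (x := (0 : E)) (r := 1) |>.2 zero_le_one
  set w : Metric.sphere (0 : E) 1 := ⟨v, hv⟩
  obtain ⟨θ₁, h₁, hl₁⟩ := exists_continuousOn_lift_compl_singleton w hφ
  obtain ⟨θ₂, h₂, hl₂⟩ := exists_continuousOn_lift_compl_singleton (-w) hφ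
  refine exists_lift_of_union isOpen_compl_singleton isOpen_compl_singleton ?_
    (isPreconnected_compl_pair_antipodal hE w) h₁ h₂ hl₁ hl₂
  rw [← compl_inter, compl_univ_iff]
  exact disjoint_iff_inter_eq_empty.1 (disjoint_singleton.2 (ne_neg_of_mem_unit_sphere ℝ w))

theorem locallyPathConnectedSpace_sphere :
    LocallyPathConnectedSpace (Metric.sphere (0 : E) 1) := by
  rw [locallyPathConnectedSpace_iff_pathComponentIn_mem_nhds]
  intro x u hu hxu
  have hv1 := norm_eq_of_mem_sphere (-x)
  set e := stereographic hv1
  have hx : x ∈ e.source := ne_neg_of_mem_unit_sphere ℝ x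
  have hcont : Continuous e.symm := continuousOn_univ.1 e.continuousOn_symm
  have hw : e x ∈ e.symm ⁻¹' u := by
    rw [mem_preimage, e.left_inv hx]
    exact hxu
  have hmem : pathComponentIn (e.symm ⁻¹' u) (e x) ∈ 𝓝 (e x) :=
    ((hu.preimage hcont).pathComponentIn _).mem_nhds (mem_pathComponentIn_self hw)
  have himg := e.symm.image_mem_nhds (x := e x) (mem_univ _) hmem
  rw [e.left_inv hx] at himg
  refine Filter.mem_of_superset himg ?_
  refine ((isPathConnected_pathComponentIn hw).image hcont).subset_pathComponentIn
    ⟨e x, mem_pathComponentIn_self hw, e.left_inv hx⟩ ?_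
  rintro _ ⟨z, hz, rfl⟩
  exact (pathComponentIn_subset hz : z ∈ e.symm ⁻¹' u)

end Sphere

/-! ### Antipodal points on a contour -/

section Sphere

variable {E : Type*} [NormedAddCommGroup E] [InnerProductSpace ℝ E] [FiniteDimensional ℝ E]

/-- Every continuous real function on a sphere of dimension at least two has a contour containing
a pair of antipodal points. -/
theorem exists_isContour_antipodal (hE : 3 ≤ Module.finrank ℝ E)
    {f : Metric.sphere (0 : E) 1 → ℝ} (hf : Continuous f) :
    ∃ C, IsContour f C ∧ ∃ x ∈ C, ∃ y ∈ C, y = -x := by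
  have hrank : 1 < Module.rank ℝ E := by
    rw [← Module.finrank_eq_rank]
    exact_mod_cast (by omega : 1 < Module.finrank ℝ E)
  have : ConnectedSpace (Metric.sphere (0 : E) 1) :=
    isConnected_iff_connectedSpace.1 (isConnected_sphere hrank 0 zero_le_one)
  have : LocallyPathConnectedSpace (Metric.sphere (0 : E) 1) := locallyPathConnectedSpace_sphere
  have : ProperSpace E := FiniteDimensional.proper ℝ E
  refine (unicoherent_sphere hE).exists_isContour_rel (fun x y => y = -x) hf ?_ ?_
  · intro C hC hCc hno
    obtain ⟨c, hc⟩ := hCc.nonempty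
    have hnc : -c ∉ C := fun h => hno c hc (-c) h rfl
    refine ⟨-c, hnc, ?_⟩
    rintro y hy _ hz rfl
    have hpre := isPreconnected_compl_connectedComponentIn_compl hC hCc (-c)
    have hneg : ∀ w ∉ connectedComponentIn Cᶜ (-c), -w ∉ C := by
      refine fun w hw hwC => hw ?_
      refine (hCc.isPreconnected.image _ continuous_neg.continuousOn).subset_connectedComponentIn
        (mem_image_of_mem _ hc) ?_ ⟨-w, hwC, neg_neg w⟩
      rintro _ ⟨a, ha, rfl⟩ haC
      exact hno a ha _ haC rfl
    -- The complement of the component containing `-C` is connected and its negative avoids `C`, so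
    -- negation sends it into that component.
    have hsub : Neg.neg '' (connectedComponentIn Cᶜ (-c))ᶜ ⊆ connectedComponentIn Cᶜ (-c) := by
      refine (hpre.image _ continuous_neg.continuousOn).subset_connectedComponentIn
        (mem_image_of_mem _ (subset_compl_connectedComponentIn_compl C (-c) hc)) ?_
      rintro _ ⟨w, hw, rfl⟩
      exact hneg w hw
    exact hz (hsub (mem_image_of_mem _ hy))
  · intro A hA h₁ h₂
    -- Negation exchanges `A` and its complement, so `A` is clopen, hence empty or everything, which
    -- is absurd.
    have hAneg : ∀ x, -x ∈ A ↔ x ∉ A := fun x =>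
      ⟨fun h hx => h₁ x hx _ h rfl, fun h => by_contra fun h' => h₂ x h _ h' rfl⟩
    have hopen : IsOpen A := by
      rw [← isClosed_compl_iff]
      convert hA.preimage continuous_neg using 1
      ext x
      exact (hAneg x).symm
    obtain ⟨x⟩ := (inferInstance : Nonempty (Metric.sphere (0 : E) 1))
    rcases isClopen_iff.1 ⟨hA, hopen⟩ with rfl | rfl
    · simpa using hAneg x
    · simpa using hAneg x

end Sphere

/-! ### The disc and chords of length at least `√3` -/

section Disc

open Complex

theorem dist_mul_exp_sq {c : ℂ} (hc : ‖c‖ = 1) (a b : ℝ) :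
    dist (c * exp (a * I)) (c * exp (b * I)) ^ 2 = 2 - 2 * Real.cos (a - b) := by
  rw [dist_eq, ← mul_sub, norm_mul, hc, one_mul, ← normSq_eq_norm_sq, normSq_apply, Real.cos_sub]
  simp only [sub_re, sub_im, exp_ofReal_mul_I_re, exp_ofReal_mul_I_im]
  linarith [Real.sin_sq_add_cos_sq a, Real.sin_sq_add_cos_sq b]

theorem sqrt_three_le_dist_mul_exp_iff {c : ℂ} (hc : ‖c‖ = 1) (a b : ℝ) :
    √3 ≤ dist (c * exp (a * I)) (c * exp (b * I)) ↔ Real.cos (a - b) ≤ -(1 / 2) := by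
  rw [Real.sqrt_le_left dist_nonneg, dist_mul_exp_sq hc]
  constructor <;> intro h <;> linarith

theorem cos_two_mul_pi_div_three : Real.cos (2 * Real.pi / 3) = -(1 / 2) := by
  rw [show 2 * Real.pi / 3 = Real.pi - Real.pi / 3 by ring, Real.cos_pi_sub, Real.cos_pi_div_three]

theorem neg_half_lt_cos {x : ℝ} (hx : |x| < 2 * Real.pi / 3) : -(1 / 2) < Real.cos x := by
  rw [← Real.cos_abs x, ← cos_two_mul_pi_div_three]
  exact Real.cos_lt_cos_of_nonneg_of_le_pi (abs_nonneg x) (by linarith [Real.pi_pos]) hx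

/-- The bound `4π/3` is needed because the cosine exceeds `-1/2` again just beyond it. -/
theorem abs_lt_of_neg_half_lt_cos {x : ℝ} (hx : |x| < 4 * Real.pi / 3)
    (h : -(1 / 2) < Real.cos x) : |x| < 2 * Real.pi / 3 := by
  by_contra! hle
  rw [← Real.cos_abs x] at h
  rcases le_total |x| Real.pi with hpi | hpi
  · have := Real.cos_le_cos_of_nonneg_of_le_pi (by positivity) hpi hle
    rw [cos_two_mul_pi_div_three] at this
    linarith
  · have := Real.cos_le_cos_of_nonneg_of_le_pi (x := 2 * Real.pi / 3) (y := 2 * Real.pi - |x|)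
      (by positivity) (by linarith) (by linarith)
    rw [cos_two_mul_pi_div_three, Real.cos_two_pi_sub] at this
    linarith

theorem exists_eq_mul_exp {c z : ℂ} (hc : ‖c‖ = 1) (hz : ‖z‖ = 1) :
    ∃ a ∈ Ioc (-Real.pi) Real.pi, z = c * exp (a * I) := by
  refine ⟨arg (z / c), arg_mem_Ioc _, ?_⟩
  have hc0 : c ≠ 0 := by rintro rfl; simp at hc
  have := norm_mul_exp_arg_mul_I (z / c)
  rw [norm_div, hc, hz, div_one, ofReal_one, one_mul] at this
  rw [this, mul_div_cancel₀ _ hc0]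

/-- A closed subset of the disc whose points on the circle are pairwise at distance less than `√3`
leaves on one side all of the circle but an arc of length less than `2π/3`. -/
theorem exists_connectedComponentIn_compl_disc {C : Set (Metric.closedBall (0 : ℂ) 1)}
    (hC : IsClosed C)
    (hno : ∀ y ∈ C, ∀ z ∈ C, ¬ (‖(y : ℂ)‖ = 1 ∧ ‖(z : ℂ)‖ = 1 ∧ √3 ≤ dist (y : ℂ) z)) :
    ∃ x ∉ C, ∀ y ∉ connectedComponentIn Cᶜ x, ∀ z ∉ connectedComponentIn Cᶜ x,
      ¬ (‖(y : ℂ)‖ = 1 ∧ ‖(z : ℂ)‖ = 1 ∧ √3 ≤ dist (y : ℂ) z) := by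
  have hpi := Real.pi_pos
  -- Angles are measured from a boundary point of `C`, which confines `C` to angles of size below
  -- `2π/3`. If `C` misses the circle, the base point is arbitrary.
  obtain ⟨c, hc1, hcC⟩ : ∃ c : ℂ, ∃ hc : ‖c‖ = 1,
      (⟨c, by simp [hc]⟩ : Metric.closedBall (0 : ℂ) 1) ∈ C ∨
      ∀ y ∈ C, ‖(y : ℂ)‖ ≠ 1 := by
    by_cases h : ∃ y ∈ C, ‖(y : ℂ)‖ = 1
    · obtain ⟨y, hy, hy1⟩ := h
      exact ⟨y, hy1, Or.inl hy⟩
    · push Not at h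
      exact ⟨1, by simp, Or.inr h⟩
  set γ : ℝ → Metric.closedBall (0 : ℂ) 1 := fun a => ⟨c * exp (a * I), by
    simp [hc1, norm_exp_ofReal_mul_I]⟩ with hγ
  have hγc : Continuous γ := by fun_prop
  have hγ1 : ∀ a, ‖(γ a : ℂ)‖ = 1 := fun a => by simp [hγ, hc1, norm_exp_ofReal_mul_I]
  have hγper : ∀ a, γ (a + 2 * Real.pi) = γ a := fun a => by
    refine Subtype.ext ?_
    simp only [hγ]
    push_cast
    rw [add_mul, exp_add, exp_two_pi_mul_I, mul_one]
  have hsurj : ∀ y : Metric.closedBall (0 : ℂ) 1, ‖(y : ℂ)‖ = 1 →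
      ∃ a ∈ Ioc (-Real.pi) Real.pi, y = γ a := fun y hy => by
    obtain ⟨a, ha, h⟩ := exists_eq_mul_exp hc1 hy
    exact ⟨a, ha, Subtype.ext h⟩
  have hdist : ∀ a b, √3 ≤ dist (γ a : ℂ) (γ b) ↔ Real.cos (a - b) ≤ -(1 / 2) :=
    sqrt_three_le_dist_mul_exp_iff hc1
  rcases hcC with hcC | hcC
  swap
  · refine ⟨γ 0, fun h => hcC _ h (hγ1 0), fun y hy z _ h => hy ?_⟩
    obtain ⟨a, -, rfl⟩ := hsurj y h.1
    refine (isPreconnected_range hγc).subset_connectedComponentIn (mem_range_self 0) ?_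
      (mem_range_self a)
    rintro _ ⟨b, rfl⟩ hb
    exact hcC _ hb (hγ1 b)
  have hγ0 : γ 0 ∈ C := by
    convert hcC
    simp
  have hpair : ∀ a b, γ a ∈ C → γ b ∈ C → -(1 / 2) < Real.cos (a - b) := fun a b ha hb => by
    by_contra! h
    exact hno _ ha _ hb ⟨hγ1 a, hγ1 b, (hdist a b).2 h⟩
  set T := Icc (-Real.pi) Real.pi ∩ γ ⁻¹' C with hT
  have hTc : IsCompact T := isCompact_Icc.inter_right (hC.preimage hγc)
  have h0T : (0 : ℝ) ∈ T := ⟨⟨by linarith, hpi.le⟩, hγ0⟩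
  have hTabs : ∀ a ∈ T, |a| < 2 * Real.pi / 3 := fun a ha =>
    abs_lt_of_neg_half_lt_cos (by have := abs_le.2 ha.1; linarith)
      (by simpa using hpair a 0 ha.2 hγ0)
  -- With `a` and `b` the extreme angles of `C`, the arc from `b` through `π` to `a + 2π` lies in
  -- one complementary component, leaving out only an arc of length `b - a < 2π/3`.
  obtain ⟨a, ha, hamin⟩ := hTc.exists_isLeast ⟨0, h0T⟩
  obtain ⟨b, hb, hbmax⟩ := hTc.exists_isGreatest ⟨0, h0T⟩
  have ha' := abs_lt.1 (hTabs a ha)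
  have hb' := abs_lt.1 (hTabs b hb)
  have ha0 := hamin h0T
  have hb0 := hbmax h0T
  have hab : b - a < 2 * Real.pi / 3 :=
    (le_abs_self _).trans_lt (abs_lt_of_neg_half_lt_cos
      (abs_lt.2 ⟨by linarith, by linarith⟩) (hpair b a hb.2 ha.2))
  have harc : γ '' Ioo b (a + 2 * Real.pi) ⊆ Cᶜ := by
    rintro _ ⟨θ, ⟨h1, h2⟩, rfl⟩ hθ
    rcases le_total θ Real.pi with h | h
    · exact h1.not_ge (hbmax ⟨⟨by linarith, h⟩, hθ⟩)
    · have hθ' : γ (θ - 2 * Real.pi) ∈ C := by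
        rw [← hγper, sub_add_cancel]
        exact hθ
      have := hamin ⟨⟨by linarith, by linarith⟩, hθ'⟩
      linarith
  have hπ : γ Real.pi ∈ γ '' Ioo b (a + 2 * Real.pi) :=
    mem_image_of_mem _ ⟨by linarith, by linarith⟩
  have hsub : γ '' Ioo b (a + 2 * Real.pi) ⊆ connectedComponentIn Cᶜ (γ Real.pi) :=
    (isPreconnected_Ioo.image _ hγc.continuousOn).subset_connectedComponentIn hπ harc
  have hrest : ∀ y ∉ connectedComponentIn Cᶜ (γ Real.pi), ‖(y : ℂ)‖ = 1 →
      ∃ θ ∈ Icc a b, y = γ θ := by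
    intro y hy hy1
    obtain ⟨θ, hθ, rfl⟩ := hsurj y hy1
    refine ⟨θ, ⟨?_, ?_⟩, rfl⟩
    · by_contra! h
      refine hy (hsub ⟨θ + 2 * Real.pi, ⟨by linarith [hθ.1], by linarith⟩, hγper θ⟩)
    · by_contra! h
      exact hy (hsub ⟨θ, ⟨h, by linarith [hθ.2]⟩, rfl⟩)
  refine ⟨γ Real.pi, harc hπ, fun y hy z hz h => ?_⟩
  obtain ⟨θ, hθ, rfl⟩ := hrest y hy h.1
  obtain ⟨η, hη, rfl⟩ := hrest z hz h.2.1
  have := neg_half_lt_cos (x := θ - η)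
    (abs_lt.2 ⟨by linarith [hθ.1, hη.2], by linarith [hθ.2, hη.1]⟩)
  exact this.not_ge ((hdist θ η).1 h.2.2)

/-- Every continuous real function on the closed disc has a contour containing two points of the
boundary circle at distance at least `√3`. -/
theorem exists_isContour_disc {f : Metric.closedBall (0 : ℂ) 1 → ℝ} (hf : Continuous f) :
    ∃ C, IsContour f C ∧ ∃ x ∈ C, ∃ y ∈ C,
      ‖(x : ℂ)‖ = 1 ∧ ‖(y : ℂ)‖ = 1 ∧ √3 ≤ dist (x : ℂ) y := by
  have hconv : Convex ℝ (Metric.closedBall (0 : ℂ) 1) := convex_closedBall 0 1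
  have hne : (Metric.closedBall (0 : ℂ) 1).Nonempty := Metric.nonempty_closedBall.2 zero_le_one
  have : ConnectedSpace (Metric.closedBall (0 : ℂ) 1) :=
    isConnected_iff_connectedSpace.1 (hconv.isConnected hne)
  have : LocallyPathConnectedSpace (Metric.closedBall (0 : ℂ) 1) := hconv.locallyPathConnectedSpace
  have : CompactSpace (Metric.closedBall (0 : ℂ) 1) :=
    isCompact_iff_compactSpace.1 (isCompact_closedBall 0 1)
  refine (hconv.unicoherent hne).exists_isContour_rel
    (fun x y => ‖(x : ℂ)‖ = 1 ∧ ‖(y : ℂ)‖ = 1 ∧ √3 ≤ dist (x : ℂ) y) hf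
    (fun C hC _ hno => exists_connectedComponentIn_compl_disc hC hno) ?_
  intro A _ h₁ h₂
  set γ : ℝ → Metric.closedBall (0 : ℂ) 1 := fun a => ⟨1 * exp (a * I), by
    simp [norm_exp_ofReal_mul_I]⟩ with hγ
  have hγ1 : ∀ a, ‖(γ a : ℂ)‖ = 1 := fun a => by simp [hγ, norm_exp_ofReal_mul_I]
  have hdist : ∀ a b, a - b = 2 * Real.pi / 3 ∨ a - b = 2 * Real.pi - 2 * Real.pi / 3 →
      √3 ≤ dist (γ a : ℂ) (γ b) := by
    intro a b h
    refine (sqrt_three_le_dist_mul_exp_iff norm_one a b).2 ?_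
    rcases h with h | h <;> rw [h]
    · exact cos_two_mul_pi_div_three.le
    · rw [Real.cos_two_pi_sub]
      exact cos_two_mul_pi_div_three.le
  have hpair : ∀ a b, a - b = 2 * Real.pi / 3 ∨ a - b = 2 * Real.pi - 2 * Real.pi / 3 →
      ¬ (γ a ∈ A ↔ γ b ∈ A) := by
    intro a b h hiff
    by_cases ha : γ a ∈ A
    · exact h₁ _ ha _ (hiff.1 ha) ⟨hγ1 a, hγ1 b, hdist a b h⟩
    · exact h₂ _ ha _ (fun hb => ha (hiff.2 hb)) ⟨hγ1 a, hγ1 b, hdist a b h⟩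
  -- Three vertices of an equilateral triangle cannot be pairwise separated by a partition into two
  -- sets.
  have e₁ := hpair (2 * Real.pi / 3) 0 (Or.inl (by ring))
  have e₂ := hpair (4 * Real.pi / 3) (2 * Real.pi / 3) (Or.inl (by ring))
  have e₃ := hpair (4 * Real.pi / 3) 0 (Or.inr (by ring))
  tauto

end Disc

/-! ### From the model spaces to the ball -/

section Transfer

variable {X Y : Type*} [TopologicalSpace X] [TopologicalSpace Y]

theorem IsContour.exists_image_subset {f : Y → ℝ} {h : X → Y} (hh : Continuous h) {C : Set X}
    (hC : IsContour (f ∘ h) C) : ∃ C', IsContour f C' ∧ h '' C ⊆ C' := by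
  obtain ⟨x, hx⟩ := hC.isConnected.nonempty
  refine ⟨_, isContour_connectedComponentIn f (h x),
    (hC.isConnected.isPreconnected.image h hh.continuousOn).subset_connectedComponentIn
      (mem_image_of_mem h hx) ?_⟩
  rintro _ ⟨y, hy, rfl⟩
  exact hC.eq_of_mem hy hx

/-- If every continuous function on `X`, mapped into the closed unit ball, has a contour joining
two points of the unit sphere whose distance lies in the closed set `S`, then the contours of every
continuous function on a set containing the open unit ball nearly join two such points. -/
theorem exists_near_contours {V : Type*} [NormedAddCommGroup V] [NormedSpace ℝ V] [ProperSpace V]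
    {i : X → V} (hi : Continuous i) (hi1 : ∀ x, ‖i x‖ ≤ 1) {S : Set ℝ} (hS : IsClosed S)
    (hX : ∀ f : X → ℝ, Continuous f → ∃ C, IsContour f C ∧ ∃ x ∈ C, ∃ y ∈ C,
      ‖i x‖ = 1 ∧ ‖i y‖ = 1 ∧ dist (i x) (i y) ∈ S)
    {c : V} {E : Set V} (hE : Metric.ball c 1 ⊆ E) {f : E → ℝ} (hf : Continuous f) :
    ∃ x ∈ Metric.sphere c 1, ∃ y ∈ Metric.sphere c 1, dist x y ∈ S ∧
      ∀ U ∈ 𝓝 x, ∀ W ∈ 𝓝 y, ∃ C : Set E, IsContour f C ∧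
        ((↑) '' C ∩ U).Nonempty ∧ ((↑) '' C ∩ W).Nonempty := by
  -- Scaling by `r n < 1` keeps the copy of `X` inside the open ball, where `f` is defined in both
  -- cases.
  obtain ⟨r, -, hr, hrlim⟩ := exists_seq_strictMono_tendsto' (zero_lt_one (α := ℝ))
  have hmem : ∀ n x, c + r n • i x ∈ E := fun n x => hE (by
    rw [mem_ball_iff_norm, add_sub_cancel_left, norm_smul, Real.norm_of_nonneg (hr n).1.le]
    exact (mul_le_of_le_one_right (hr n).1.le (hi1 x)).trans_lt (hr n).2)
  have hstep : ∀ n, ∃ p : V × V, p ∈ Metric.sphere (0 : V) 1 ×ˢ Metric.sphere (0 : V) 1 ∧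
      dist p.1 p.2 ∈ S ∧ ∃ C : Set E, IsContour f C ∧ c + r n • p.1 ∈ (↑) '' C ∧
        c + r n • p.2 ∈ (↑) '' C := by
    intro n
    have hh : Continuous fun x => (⟨c + r n • i x, hmem n x⟩ : E) := by fun_prop
    obtain ⟨C, hC, x, hx, y, hy, hx1, hy1, hxy⟩ := hX _ (hf.comp hh)
    obtain ⟨C', hC', hsub⟩ := IsContour.exists_image_subset hh hC
    exact ⟨(i x, i y), ⟨by simpa using hx1, by simpa using hy1⟩, hxy, C', hC',
      ⟨_, hsub ⟨x, hx, rfl⟩, rfl⟩, ⟨_, hsub ⟨y, hy, rfl⟩, rfl⟩⟩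
  choose p hp hpS C hC hC1 hC2 using hstep
  obtain ⟨⟨x, y⟩, ⟨hx, hy⟩, φ, hφ, hlim⟩ :=
    ((isCompact_sphere (0 : V) 1).prod (isCompact_sphere (0 : V) 1)).tendsto_subseq hp
  have hx' : Filter.Tendsto (fun n => (p (φ n)).1) Filter.atTop (𝓝 x) :=
    (continuous_fst.tendsto _).comp hlim
  have hy' : Filter.Tendsto (fun n => (p (φ n)).2) Filter.atTop (𝓝 y) :=
    (continuous_snd.tendsto _).comp hlim
  have hr' := hrlim.comp hφ.tendsto_atTop
  have hxlim := (hr'.smul hx').const_add c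
  have hylim := (hr'.smul hy').const_add c
  rw [one_smul] at hxlim hylim
  refine ⟨c + x, by simpa using hx, c + y, by simpa using hy, ?_, fun U hU W hW => ?_⟩
  · rw [dist_add_left]
    exact hS.mem_of_tendsto (hx'.dist hy') (Filter.Eventually.of_forall fun n => hpS _)
  · obtain ⟨n, hnU, hnW⟩ := ((hxlim.eventually_mem hU).and (hylim.eventually_mem hW)).exists
    exact ⟨C (φ n), hC _, ⟨_, hC1 _, hnU⟩, ⟨_, hC2 _, hnW⟩⟩

end Transfer

/-! ### Bounds on the Reeb width -/

section ReebWidth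

variable {V : Type*} [NormedAddCommGroup V] {E : Set V}

theorem ofReal_le_reebWidth {d : ℝ}
    (h : ∀ f : E → ℝ, Continuous f → ∃ x y : V, d ≤ dist x y ∧
      ∀ U ∈ 𝓝 x, ∀ W ∈ 𝓝 y, ∃ C : Set E, IsContour f C ∧
        (((↑) '' C : Set V) ∩ U).Nonempty ∧ (((↑) '' C : Set V) ∩ W).Nonempty) :
    ENNReal.ofReal d ≤ reebWidth E := by
  refine le_iInf₂ fun f hf => ?_
  obtain ⟨x, y, hxy, hC⟩ := h f hf
  refine ENNReal.le_of_forall_pos_le_add fun ε hε _ => ?_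
  obtain ⟨C, hCf, ⟨a', ⟨a, ha, rfl⟩, hax⟩, ⟨b', ⟨b, hb, rfl⟩, hby⟩⟩ :=
    hC _ (Metric.ball_mem_nhds x (half_pos hε)) _ (Metric.ball_mem_nhds y (half_pos hε))
  have hle : d ≤ dist a b + ε := by
    have h1 := dist_triangle4 x a b y
    have h2 : dist x a < ε / 2 := by rw [dist_comm]; exact hax
    have h3 : dist (b : V) y < ε / 2 := hby
    have h4 : dist (a : V) b = dist a b := rfl
    linarith
  calc ENNReal.ofReal d ≤ ENNReal.ofReal (dist a b + ε) := ENNReal.ofReal_le_ofReal hle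
    _ = edist a b + ε := by
      rw [ENNReal.ofReal_add dist_nonneg ε.coe_nonneg, edist_dist, ENNReal.ofReal_coe_nnreal]
    _ ≤ _ := by
      gcongr
      exact (Metric.edist_le_ediam_of_mem ha hb).trans
        (le_iSup₂ (f := fun (C : Set E) (_ : IsContour f C) => Metric.ediam C) C hCf)

theorem reebWidth_le_two {c : V} (hE : E ⊆ Metric.closedBall c 1) : reebWidth E ≤ 2 := by
  refine iInf₂_le_of_le (fun _ => 0) continuous_const (iSup₂_le fun C _ => ?_)
  refine Metric.ediam_le fun x _ y _ => ?_
  rw [edist_dist]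
  refine ENNReal.ofReal_le_of_le_toReal ?_
  have h1 : dist (x : V) c ≤ 1 := hE x.2
  have h2 : dist (y : V) c ≤ 1 := hE y.2
  have := dist_triangle_right (x : V) y c
  have h3 : dist (x : V) y = dist x y := rfl
  norm_num
  linarith

end ReebWidth

theorem proposition6p3 (n : ℕ) (hn : 2 ≤ n) (c : EuclideanSpace ℝ (Fin n))
    (E : Set (EuclideanSpace ℝ (Fin n)))
    (hE : E = Metric.ball c 1 ∨ E = Metric.closedBall c 1) :
    (n = 2 → ENNReal.ofReal (Real.sqrt 3) ≤ reebWidth E) ∧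
    (3 ≤ n → reebWidth E = 2) ∧
    ∀ f : E → ℝ, Continuous f →
      ∃ x ∈ frontier E, ∃ y ∈ frontier E,
        (n = 2 → Real.sqrt 3 ≤ dist x y) ∧
        (3 ≤ n → dist x y = 2) ∧
        ∀ U ∈ nhds x, ∀ V ∈ nhds y, ∃ C : Set E, IsContour f C ∧
          (((↑) '' C : Set (EuclideanSpace ℝ (Fin n))) ∩ U).Nonempty ∧
          (((↑) '' C : Set (EuclideanSpace ℝ (Fin n))) ∩ V).Nonempty := by
  have hball : Metric.ball c 1 ⊆ E := by
    rcases hE with rfl | rfl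
    exacts [subset_rfl, Metric.ball_subset_closedBall]
  have hclosed : E ⊆ Metric.closedBall c 1 := by
    rcases hE with rfl | rfl
    exacts [Metric.ball_subset_closedBall, subset_rfl]
  have hfr : frontier E = Metric.sphere c 1 := by
    rcases hE with rfl | rfl
    exacts [frontier_ball c one_ne_zero, frontier_closedBall c one_ne_zero]
  have key : ∀ f : E → ℝ, Continuous f → ∃ x ∈ frontier E, ∃ y ∈ frontier E,
        (n = 2 → Real.sqrt 3 ≤ dist x y) ∧ (3 ≤ n → dist x y = 2) ∧
        ∀ U ∈ nhds x, ∀ V ∈ nhds y, ∃ C : Set E, IsContour f C ∧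
          (((↑) '' C : Set (EuclideanSpace ℝ (Fin n))) ∩ U).Nonempty ∧
          (((↑) '' C : Set (EuclideanSpace ℝ (Fin n))) ∩ V).Nonempty := by
    intro f hf
    rw [hfr]
    rcases hn.eq_or_lt with rfl | hn3
    · set e := Complex.orthonormalBasisOneI.repr
      obtain ⟨x, hx, y, hy, hxy, hC⟩ := exists_near_contours
        (i := fun z : Metric.closedBall (0 : ℂ) 1 => e z) (by fun_prop)
        (fun z => by rw [e.norm_map]; exact mem_closedBall_zero_iff.1 z.2) (isClosed_Ici (a := √3))
        (fun f hf => by simpa using exists_isContour_disc hf) hball hf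
      exact ⟨x, hx, y, hy, fun _ => hxy, fun h => absurd h (by norm_num), hC⟩
    · obtain ⟨x, hx, y, hy, hxy, hC⟩ := exists_near_contours
        (i := fun z : Metric.sphere (0 : EuclideanSpace ℝ (Fin n)) 1 =>
          (z : EuclideanSpace ℝ (Fin n))) continuous_subtype_val
        (fun z => (norm_eq_of_mem_sphere z).le) (isClosed_singleton (x := (2 : ℝ)))
        (fun f hf => by
          obtain ⟨C, hC, x, hx, y, hy, rfl⟩ := exists_isContour_antipodal (by rw [finrank_euclideanSpace_fin]; exact hn3) hf
          refine ⟨C, hC, x, hx, -x, hy, norm_eq_of_mem_sphere x, norm_eq_of_mem_sphere (-x), ?_⟩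
          rw [mem_singleton_iff, coe_neg_sphere, dist_eq_norm, sub_neg_eq_add, ← two_smul ℝ,
            norm_smul, norm_eq_of_mem_sphere]
          norm_num) hball hf
      exact ⟨x, hx, y, hy, fun h => absurd h hn3.ne', fun _ => hxy, hC⟩
  refine ⟨fun h2 => ofReal_le_reebWidth fun f hf => ?_, fun h3 => ?_, key⟩
  · obtain ⟨x, -, y, -, hxy, -, hC⟩ := key f hf
    exact ⟨x, y, hxy h2, hC⟩
  · refine le_antisymm (reebWidth_le_two hclosed) ?_
    have := ofReal_le_reebWidth (E := E) (d := 2) fun f hf => by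
      obtain ⟨x, -, y, -, -, hxy, hC⟩ := key f hf
      exact ⟨x, y, (hxy h3).ge, hC⟩
    simpa using this
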